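/- **Setting.** Let $d,k\ge 1$. A weighted data set $(X,\Omega)$ is a family of points $x_1,\dots,x_n\in\mathbb{R}^d$ (repetitions allowed) with weights $\omega_1,\dots,\omega_n>0$. Let $\mathcal{A}=(A_1,\dots,A_k)$ be symmetric positive definite $d\times d$ matrices, let $\lambda^+(\mathcal{A})$ and $\lambda^-(\mathcal{A})$ be the largest and the smallest eigenvalue occurring among them, and write $\|x\|_{A}^2=x^{\top}Ax$. Let $\mathrm{K}$ consist of bounds $\kappa_i^-\in\mathbb{R}$, $\kappa_i^+\in\mathbb{R}\cup\{\infty\}$ $(i\in[k])$. Let $\mathcal{C}_{\mathrm{K}}(k,X,\Omega)$ be the set of all $C=(\xi_{ij})$ with $\xi_{ij}\ge 0$, $\sum_i\xi_{ij}=1$ for all $j$, and $\kappa_i^-\le\sum_j\xi_{ij}\omega_j\le\kappa_i^+$ for all $i$; it is assumed to be non-empty. For sites $S=(s_1,\dots,s_k)$ in $\mathbb{R}^d$ put $\mathrm{cost}(X,C,S)=\sum_{i,j}\xi_{ij}\omega_j\|x_j-s_i\|_{A_i}^2$ and $\mathrm{cost}(X,S)=\min_{C\in\mathcal{C}_{\mathrm{K}}(k,X,\Omega)}\mathrm{cost}(X,C,S)$.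 Let $\mathrm{OPT}(X)$ be the minimum of $\sum_{i,j}\xi_{ij}\omega_j\|x_j-s_i\|_2^2$ over all sites and all clusterings without weight bounds. For $\epsilon\in(0,\frac12]$ and $\delta\ge 1$, a weighted data set $(\tilde X,\tilde\Omega)$ is an $(\epsilon,\delta)$-coreset for $(k,X,\Omega,\mathcal{A},\mathrm{K})$ with offsets $\Delta^+,\Delta^-$, where $0\le\Delta^+\le\delta\Delta^-$, if there is a map $f:\mathcal{C}_{\mathrm{K}}(k,\tilde X,\tilde\Omega)\to\mathcal{C}_{\mathrm{K}}(k,X,\Omega)$ such that, for all $S$ and all $\tilde C\in\mathcal{C}_{\mathrm{K}}(k,\tilde X,\tilde\Omega)$, $$(1-\epsilon)\,\mathrm{cost}(X,f(\tilde C),S)\le\mathrm{cost}(\tilde X,\tilde C,S)+\Delta^+,\qquad \mathrm{cost}(\tilde X,S)+\Delta^-\le(1+\epsilon)\,\mathrm{cost}(X,S).$$ **Construction.** Let $\epsilon\in(0,\frac12]$, $\alpha\ge 1$, $\beta\in\mathbb{N}$. Let an assignment of the points of $X$ to at most $\beta k$ clusters be given whose Euclidean cost $\mathrm{ALG}$ (the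 weighted sum of the squared distances of the points to the centroids of their clusters) satisfies $\mathrm{ALG}\le\alpha\,\mathrm{OPT}(X)$. Let $Q\subset\mathbb{R}^d\setminus\{0\}$ be a finite set such that each point of the Euclidean unit sphere has distance at most $\epsilon_0=\frac{\epsilon}{4}\sqrt{\lambda^-(\mathcal{A})/(\alpha\lambda^+(\mathcal{A}))}$ from some point of $Q$. Let $\mathcal{L}$ be the set of all lines $\hat c+\mathbb{R}q$ with $\hat c$ the centroid of a non-void cluster and $q\in Q$. Let $\bar x_j$ be the orthogonal projection of $x_j$ to a closest line among the lines $\hat c+\mathbb{R}q$, $q\in Q$, where $\hat c$ is the centroid of the cluster of $x_j$, and let $\bar X=(\bar x_1,\dots,\bar x_n)$, with the weights $\Omega$. Let $$0\le\mathcal{V}\le\frac{\epsilon^2\,\lambda^-(\mathcal{A})}{32\,\alpha\,k\,\lambda^+(\mathcal{A})\,|\mathcal{L}|}\,\mathrm{ALG}.$$ Assign each $\bar x_j$ to one line of $\mathcal{L}$ that contains it, and divide, on each line, the weights of the points assigned to it, from left to right, into consecutive batches $B$ of positive weight, where the weight of a point may be split between batches. Here each batch $B$, with total weight $\omega_B$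 and centroid $x_B$, has Euclidean variation $\mathcal{V}_E(B)=\sum_j\omega_{j}^{B}\|\bar x_j-x_B\|_2^2$ equal to $\mathcal{V}$ ($\omega_j^B$ being the part of $\omega_j$ in $B$), except for the last batch on each line, whose variation may be smaller. Let $\mathcal{B}$ be the set of all batches, and let $(X_{\mathcal{B}},\Omega_{\mathcal{B}})$ be the weighted data set of the points $x_B$ with weights $\omega_B$, $B\in\mathcal{B}$. **Theorem.** $(X_{\mathcal{B}},\Omega_{\mathcal{B}})$ is an $\left(\epsilon,\frac{\lambda^+(\mathcal{A})}{\lambda^-(\mathcal{A})}\right)$-coreset for $(k,\bar X,\Omega,\mathcal{A},\mathrm{K})$, with the offsets $$\Delta^{+}=\lambda^{+}(\mathcal{A})\sum_{B\in\mathcal{B}}\mathcal{V}_E(B),\qquad \Delta^{-}=\lambda^{-}(\mathcal{A})\sum_{B\in\mathcal{B}}\mathcal{V}_E(B).$$ -/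

import Mathlib

open scoped BigOperators Matrix

namespace WCA

noncomputable section

/-- Points of `ℝ^d` with the Euclidean norm. -/
abbrev Pt (d : ℕ) : Type := EuclideanSpace ℝ (Fin d)

/-- A weighted data set: a family of `n` points of `ℝ^d` (repetitions allowed) together with
positive weights. -/
structure WeightedDataSet (d n : ℕ) where
  pt : Fin n → Pt d
  wt : Fin n → ℝ
  wt_pos : ∀ j, 0 < wt j

/-- The data set with the same weights whose points are moved to `Y`. -/
def WeightedDataSet.move {d n : ℕ} (X : WeightedDataSet d n) (Y : Fin n → Pt d) :
    WeightedDataSet d n where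
  pt := Y
  wt := X.wt
  wt_pos := X.wt_pos

/-- The squared ellipsoidal norm `‖x‖_A² = xᵀ A x`. -/
def ellSq {d : ℕ} (A : Matrix (Fin d) (Fin d) ℝ) (x : Pt d) : ℝ :=
  x.ofLp ⬝ᵥ (A *ᵥ x.ofLp)

/-- The set of all eigenvalues of all matrices of the family `A`. -/
def eigenvalueSet {d k : ℕ} (A : Fin k → Matrix (Fin d) (Fin d) ℝ) : Set ℝ :=
  {μ | ∃ i, Module.End.HasEigenvalue (Matrix.toLin' (A i)) μ}

/-- The largest eigenvalue of all matrices of the family. -/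
def lamMax {d k : ℕ} (A : Fin k → Matrix (Fin d) (Fin d) ℝ) : ℝ := sSup (eigenvalueSet A)

/-- The smallest eigenvalue of all matrices of the family. -/
def lamMin {d k : ℕ} (A : Fin k → Matrix (Fin d) (Fin d) ℝ) : ℝ := sInf (eigenvalueSet A)

/-! ### Weight-constrained clusterings and their costs -/

/-- The weight-constrained `k`-clusterings of `X`: `ξ i j` is the fraction of the `j`-th point
that is assigned to the `i`-th cluster, and the weight of the `i`-th cluster lies between `lo i`
and `hi i`; `hi i = ⊤` means that there is no upper bound. -/
def clusterings {d n k : ℕ} (X : WeightedDataSet d n) (lo : Fin k → ℝ) (hi : Fin k → WithTop ℝ) :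
    Set (Fin k → Fin n → ℝ) :=
  {ξ | (∀ i j, 0 ≤ ξ i j) ∧ (∀ j, ∑ i, ξ i j = 1) ∧
    ∀ i, lo i ≤ ∑ j, ξ i j * X.wt j ∧ ((∑ j, ξ i j * X.wt j : ℝ) : WithTop ℝ) ≤ hi i}

/-- The cost of the clustering `ξ` of `X` with respect to the sites `S`. -/
def cost {d n k : ℕ} (X : WeightedDataSet d n) (A : Fin k → Matrix (Fin d) (Fin d) ℝ)
    (ξ : Fin k → Fin n → ℝ) (S : Fin k → Pt d) : ℝ :=
  ∑ i, ∑ j, ξ i j * X.wt j * ellSq (A i) (X.pt j - S i)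

/-- The minimal cost of a weight-constrained clustering of `X` for fixed sites `S`. -/
def siteCost {d n k : ℕ} (X : WeightedDataSet d n) (A : Fin k → Matrix (Fin d) (Fin d) ℝ)
    (lo : Fin k → ℝ) (hi : Fin k → WithTop ℝ) (S : Fin k → Pt d) : ℝ :=
  sInf ((fun ξ => cost X A ξ S) '' clusterings X lo hi)

/-- The minimal cost over all sites for a fixed clustering. -/
def clusteringCost {d n k : ℕ} (X : WeightedDataSet d n) (A : Fin k → Matrix (Fin d) (Fin d) ℝ)
    (ξ : Fin k → Fin n → ℝ) : ℝ :=
  ⨅ S : Fin k → Pt d, cost X A ξ S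

/-- The cost of an optimal weight-constrained anisotropic clustering. -/
def optCost {d n k : ℕ} (X : WeightedDataSet d n) (A : Fin k → Matrix (Fin d) (Fin d) ℝ)
    (lo : Fin k → ℝ) (hi : Fin k → WithTop ℝ) : ℝ :=
  sInf ((fun ξ => clusteringCost X A ξ) '' clusterings X lo hi)

/-- The cost of an optimal unconstrained Euclidean least-squares `k`-clustering. -/
def optLS {d n : ℕ} (k : ℕ) (X : WeightedDataSet d n) : ℝ :=
  optCost (k := k) X (fun _ => 1) (fun _ => 0) (fun _ => ⊤)

/-! ### Coresets -/

/-- `X'` is an `(ε, δ)`-coreset for the instance `(k, X, A, (lo, hi))`, with offsets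
`Δp` (in the first condition) and `Δm` (in the second one). -/
def IsCoresetWithOffsets {d n n' k : ℕ} (ε δ Δp Δm : ℝ)
    (X : WeightedDataSet d n) (X' : WeightedDataSet d n')
    (A : Fin k → Matrix (Fin d) (Fin d) ℝ) (lo : Fin k → ℝ) (hi : Fin k → WithTop ℝ) : Prop :=
  (0 < ε ∧ ε ≤ 1 / 2) ∧ 1 ≤ δ ∧ (0 ≤ Δp ∧ Δp ≤ δ * Δm) ∧
  ∃ f : clusterings X' lo hi → clusterings X lo hi, ∀ S : Fin k → Pt d,
    (∀ ξ : clusterings X' lo hi,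
      (1 - ε) * cost X A (f ξ).1 S ≤ cost X' A ξ.1 S + Δp) ∧
    siteCost X' A lo hi S + Δm ≤ (1 + ε) * siteCost X A lo hi S

/-- `X'` is an `(ε, δ)`-coreset for the instance `(k, X, A, (lo, hi))`. -/
def IsCoreset {d n n' k : ℕ} (ε δ : ℝ)
    (X : WeightedDataSet d n) (X' : WeightedDataSet d n')
    (A : Fin k → Matrix (Fin d) (Fin d) ℝ) (lo : Fin k → ℝ) (hi : Fin k → WithTop ℝ) : Prop :=
  ∃ Δp Δm : ℝ, IsCoresetWithOffsets ε δ Δp Δm X X' A lo hi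

/-! ### The initial approximation, the pencils of lines and the projection -/

/-- The centroid of the `i`-th cluster of the integer assignment `a` (the origin if the cluster
is void). -/
def intCentroid {d n K : ℕ} (X : WeightedDataSet d n) (a : Fin n → Fin K) (i : Fin K) : Pt d :=
  (∑ j with a j = i, X.wt j)⁻¹ • ∑ j with a j = i, X.wt j • X.pt j

/-- The Euclidean least-squares cost of the integer assignment `a`. -/
def intCost {d n K : ℕ} (X : WeightedDataSet d n) (a : Fin n → Fin K) : ℝ :=
  ∑ j, X.wt j * ‖X.pt j - intCentroid X a (a j)‖ ^ 2

/-- The integer assignment `a` to `K` clusters is an `(α, β)`-approximation for unconstrained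
least-squares `k`-clustering of `X`. -/
def IsApproximation {d n K : ℕ} (α : ℝ) (β k : ℕ) (X : WeightedDataSet d n)
    (a : Fin n → Fin K) : Prop :=
  K ≤ β * k ∧ intCost X a ≤ α * optLS k X

/-- The line `c + ℝ q`. -/
def lineThrough {d : ℕ} (c q : Pt d) : Set (Pt d) := {y | ∃ t : ℝ, y = c + t • q}

/-- `Q` is a finite set of nonzero directions that contains, for each point of the unit sphere,
a point at distance at most `ε₀`. -/
def IsDirectionNet {d : ℕ} (ε₀ : ℝ) (Q : Finset (Pt d)) : Prop :=
  0 ∉ Q ∧ ∀ p : Pt d, ‖p‖ = 1 → ∃ q ∈ Q, ‖p - q‖ ≤ ε₀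

/-- The set of all lines with a direction in `Q` through the centroid of a non-void cluster. -/
def pencilLines {d n K : ℕ} (X : WeightedDataSet d n) (a : Fin n → Fin K) (Q : Finset (Pt d)) :
    Set (Set (Pt d)) :=
  {L | ∃ j : Fin n, ∃ q ∈ Q, L = lineThrough (intCentroid X a (a j)) q}

/-- `y` is the orthogonal projection of `x` to the line `L`. -/
def IsOrthProj {d : ℕ} (L : Set (Pt d)) (x y : Pt d) : Prop :=
  y ∈ L ∧ ∀ z ∈ L, inner ℝ (x - y) (z - y) = 0

/-- Every `Y j` is the orthogonal projection of the `j`-th point to a closest line of the pencil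
that issues from the centroid of its cluster. -/
def IsPencilProjection {d n K : ℕ} (X : WeightedDataSet d n) (a : Fin n → Fin K)
    (Q : Finset (Pt d)) (Y : Fin n → Pt d) : Prop :=
  ∀ j, ∃ q ∈ Q, IsOrthProj (lineThrough (intCentroid X a (a j)) q) (X.pt j) (Y j) ∧
    ∀ q' ∈ Q, Metric.infDist (X.pt j) (lineThrough (intCentroid X a (a j)) q) ≤
      Metric.infDist (X.pt j) (lineThrough (intCentroid X a (a j)) q')

/-! ### Batches -/

/-- The total weight of a batch; `w j` is the part of the weight of the `j`-th point that belongs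
to the batch. -/
def batchWeight {n : ℕ} (w : Fin n → ℝ) : ℝ := ∑ j, w j

/-- The centroid of a batch. -/
def batchCentroid {d n : ℕ} (x : Fin n → Pt d) (w : Fin n → ℝ) : Pt d :=
  (batchWeight w)⁻¹ • ∑ j, w j • x j

/-- The Euclidean variation of a batch. -/
def batchVariation {d n : ℕ} (x : Fin n → Pt d) (w : Fin n → ℝ) : ℝ :=
  ∑ j, w j * ‖x j - batchCentroid x w‖ ^ 2

/-- A division of the data set `X`, which lies on the lines of the set `𝓛`, into `m` batches of
Euclidean variation `V`. Each point is handled on one line of `𝓛` containing it. On each line the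
batches are filled from left to right, points being split between batches if needed. All
batches on a line have variation `V`, except that the last one may have a smaller variation. -/
structure Batching {d n : ℕ} (X : WeightedDataSet d n) (𝓛 : Set (Set (Pt d))) (V : ℝ)
    (m : ℕ) where
  /-- The line on which a point is handled. -/
  pointLine : Fin n → Set (Pt d)
  /-- The line of a batch. -/
  line : Fin m → Set (Pt d)
  /-- The part of the weight of the `j`-th point that is put into the batch `b`. -/
  mass : Fin m → Fin n → ℝ
  pointLine_mem : ∀ j, pointLine j ∈ 𝓛
  pt_mem : ∀ j, X.pt j ∈ pointLine j
  line_mem : ∀ b, line b ∈ 𝓛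
  mass_nonneg : ∀ b j, 0 ≤ mass b j
  mass_line : ∀ b j, 0 < mass b j → pointLine j = line b
  mass_sum : ∀ j, ∑ b, mass b j = X.wt j
  batch_nonempty : ∀ b, 0 < batchWeight (mass b)
  left_to_right : ∀ L ∈ 𝓛, ∃ c u : Pt d, u ≠ 0 ∧ L = lineThrough c u ∧
    ∀ b b', b < b' → line b = L → line b' = L →
      ∀ j j', 0 < mass b j → 0 < mass b' j' → inner ℝ u (X.pt j) ≤ inner ℝ u (X.pt j')
  variation_eq : ∀ b b', b < b' → line b = line b' → batchVariation X.pt (mass b) = V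
  variation_le : ∀ b, batchVariation X.pt (mass b) ≤ V

/-- The batched data set: every batch is replaced by its centroid, with the total weight of the
batch. -/
def Batching.batched {d n m : ℕ} {X : WeightedDataSet d n} {𝓛 : Set (Set (Pt d))} {V : ℝ}
    (B : Batching X 𝓛 V m) : WeightedDataSet d m where
  pt b := batchCentroid X.pt (B.mass b)
  wt b := batchWeight (B.mass b)
  wt_pos := B.batch_nonempty

/-- The sum of the Euclidean variations of all batches. -/
def Batching.totalVariation {d n m : ℕ} {X : WeightedDataSet d n} {𝓛 : Set (Set (Pt d))} {V : ℝ}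
    (B : Batching X 𝓛 V m) : ℝ :=
  ∑ b, batchVariation X.pt (B.mass b)

end

end WCA

namespace WCA

noncomputable section

/-! ### Ellipsoidal norms -/

/-! Weight is transported between points and batches along the masses, which preserves all cluster
weights exactly. From batches to points (`Batching.pull`), every point of a batch inherits the same
fractions, so the parallel axis theorem shows that the cost grows by at most the variations scaled
by `lamMax A` (`Batching.cost_pull_le`).

Conversely, take an optimal clustering of the points and push it to the batches. A batch that lies
in one cluster, or at one position, becomes cheaper by at least its variation scaled by `lamMin A`.
Only batches that separate clusters at different positions can do harm, so they must be few. On a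
line, the difference of the squared distances to two sites is a quadratic polynomial, even for
different matrices. If two clusters alternated i, i', i, i', exchanges of weight would force this
polynomial to be constant; a secondary linear objective, minimised among the optima, excludes that
tie (`no_alternation`). Hence a split batch is near the first or last occurrence of a cluster on its
line, which leaves at most four per cluster and line (`Batching.card_isSplit_le`).

Each split batch costs a relative error ε/2 plus a multiple of `lamMax A * V`. The bound on `V`
makes the sum of the latter small against the cost of the initial assignment, which in turn is
controlled by the cost of any clustering of the projected points (`lamMin_mul_intCost_le`). -/

/-- The bilinear form that belongs to `ellSq A`. -/
def ellBilin {d : ℕ} (A : Matrix (Fin d) (Fin d) ℝ) (x y : Pt d) : ℝ :=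
  x.ofLp ⬝ᵥ (A *ᵥ y.ofLp)

section Ellipsoidal

variable {d : ℕ} {A : Matrix (Fin d) (Fin d) ℝ}

theorem ellBilin_comm (hA : A.IsHermitian) (x y : Pt d) : ellBilin A x y = ellBilin A y x := by
  have hT : Aᵀ = A := by
    simpa [Matrix.IsHermitian, Matrix.conjTranspose_eq_transpose_of_trivial] using hA
  unfold ellBilin
  rw [Matrix.dotProduct_mulVec, ← Matrix.mulVec_transpose, hT, dotProduct_comm]

theorem ellBilin_add_left (x y z : Pt d) :
    ellBilin A (x + y) z = ellBilin A x z + ellBilin A y z := by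
  simp [ellBilin, add_dotProduct]

theorem ellBilin_smul_left (t : ℝ) (x z : Pt d) :
    ellBilin A (t • x) z = t * ellBilin A x z := by
  simp [ellBilin, smul_dotProduct]

theorem ellBilin_sum_left {ι : Type*} (s : Finset ι) (x : ι → Pt d) (z : Pt d) :
    ellBilin A (∑ j ∈ s, x j) z = ∑ j ∈ s, ellBilin A (x j) z := by
  classical
  induction s using Finset.induction_on with
  | empty => simp [ellBilin]
  | insert a s ha ih => rw [Finset.sum_insert ha, Finset.sum_insert ha, ellBilin_add_left, ih]

theorem ellSq_add (hA : A.IsHermitian) (x y : Pt d) :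
    ellSq A (x + y) = ellSq A x + 2 * ellBilin A x y + ellSq A y := by
  have h := ellBilin_comm hA x y
  unfold ellBilin at h
  simp only [ellSq, ellBilin, WithLp.ofLp_add, add_dotProduct, Matrix.mulVec_add, dotProduct_add]
  linarith

theorem ellSq_smul (t : ℝ) (x : Pt d) : ellSq A (t • x) = t ^ 2 * ellSq A x := by
  simp only [ellSq, WithLp.ofLp_smul, smul_dotProduct, Matrix.mulVec_smul, dotProduct_smul,
    smul_eq_mul]
  ring

theorem ellSq_one (x : Pt d) : ellSq 1 x = ‖x‖ ^ 2 := by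
  rw [ellSq, Matrix.one_mulVec, EuclideanSpace.real_norm_sq_eq]
  simp [dotProduct, sq]

theorem ellSq_nonneg (hA : A.PosDef) (x : Pt d) : 0 ≤ ellSq A x := by
  simpa [ellSq] using hA.posSemidef.dotProduct_mulVec_nonneg x.ofLp

/-- The square of `y - η x` is nonnegative; division by `η` bounds the cross term. The free `η`
trades relative against additive error. -/
theorem ellSq_add_le (hA : A.PosDef) (x y : Pt d) {η : ℝ} (hη : 0 < η) :
    ellSq A (x + y) ≤ (1 + η) * ellSq A x + (1 + 1 / η) * ellSq A y := by
  have h := ellSq_nonneg hA ((-η) • x + y)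
  rw [ellSq_add hA.isHermitian, ellSq_smul, ellBilin_smul_left] at h
  rw [ellSq_add hA.isHermitian]
  have h2 : 0 ≤ (1 / η) * ((-η) ^ 2 * ellSq A x + 2 * (-η * ellBilin A x y) + ellSq A y) := by
    positivity
  have h3 : (1 / η) * ((-η) ^ 2 * ellSq A x + 2 * (-η * ellBilin A x y) + ellSq A y) =
      η * ellSq A x - 2 * ellBilin A x y + (1 / η) * ellSq A y := by
    field_simp
    ring
  linarith

/-- Along a line, the squared distance to a site is a quadratic polynomial. -/
theorem ellSq_line (hA : A.IsHermitian) (c u s : Pt d) (t : ℝ) :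
    ellSq A (c + t • u - s) =
      ellSq A u * t ^ 2 + 2 * ellBilin A u (c - s) * t + ellSq A (c - s) := by
  have : c + t • u - s = t • u + (c - s) := by abel
  rw [this, ellSq_add hA, ellSq_smul, ellBilin_smul_left]
  ring

/-- Parseval in an orthonormal eigenbasis. It reduces both comparisons with the Euclidean norm to
comparing eigenvalues term by term. -/
theorem ellSq_eq_sum_eigenvalues (hA : A.IsHermitian) (x : Pt d) :
    ellSq A x = ∑ i, hA.eigenvalues i * (inner ℝ (hA.eigenvectorBasis i) x) ^ 2 := by
  have h1 : ellSq A x = inner ℝ x (WithLp.toLp 2 (A *ᵥ x.ofLp)) := by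
    simp [ellSq, PiLp.inner_apply, dotProduct, mul_comm]
  rw [h1, ← hA.eigenvectorBasis.sum_inner_mul_inner x]
  refine Finset.sum_congr rfl fun i _ => ?_
  have h2 : inner ℝ (hA.eigenvectorBasis i) (WithLp.toLp 2 (A *ᵥ x.ofLp)) =
      ellBilin A (hA.eigenvectorBasis i) x := by
    simp [ellBilin, PiLp.inner_apply, dotProduct, mul_comm]
  have h3 : ellBilin A x (hA.eigenvectorBasis i) =
      hA.eigenvalues i * inner ℝ x (hA.eigenvectorBasis i) := by
    rw [ellBilin, hA.mulVec_eigenvectorBasis, dotProduct_smul]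
    simp [PiLp.inner_apply, dotProduct, mul_comm]
  rw [h2, ellBilin_comm hA, h3, real_inner_comm x]
  ring

end Ellipsoidal

/-! ### Extreme eigenvalues of the family of matrices. -/

section Extremes

variable {d k : ℕ} {A : Fin k → Matrix (Fin d) (Fin d) ℝ}

theorem mem_eigenvalueSet_iff {μ : ℝ} : μ ∈ eigenvalueSet A ↔ ∃ i, μ ∈ spectrum ℝ (A i) := by
  unfold eigenvalueSet
  refine exists_congr fun i => ?_
  rw [Module.End.hasEigenvalue_iff_mem_spectrum, Matrix.spectrum_toLin']

/-- Finiteness makes the supremum and infimum genuine bounds, and the infimum attained once `d` and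
`k` are positive; otherwise they could be default values. -/
theorem finite_eigenvalueSet (A : Fin k → Matrix (Fin d) (Fin d) ℝ) :
    (eigenvalueSet A).Finite := by
  have : eigenvalueSet A = ⋃ i, spectrum ℝ (A i) := by
    ext μ
    simp [mem_eigenvalueSet_iff]
  rw [this]
  exact Set.finite_iUnion fun i => Matrix.finite_real_spectrum

theorem eigenvalues_mem_eigenvalueSet (hA : ∀ i, (A i).PosDef) (i : Fin k) (l : Fin d) :
    (hA i).isHermitian.eigenvalues l ∈ eigenvalueSet A :=
  mem_eigenvalueSet_iff.2 ⟨i, (hA i).isHermitian.eigenvalues_mem_spectrum_real l⟩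

theorem eigenvalueSet_pos (hA : ∀ i, (A i).PosDef) {μ : ℝ} (hμ : μ ∈ eigenvalueSet A) : 0 < μ := by
  obtain ⟨i, hi⟩ := mem_eigenvalueSet_iff.1 hμ
  rw [(hA i).isHermitian.spectrum_real_eq_range_eigenvalues] at hi
  obtain ⟨l, rfl⟩ := hi
  exact (hA i).eigenvalues_pos l

theorem lamMin_pos (hd : 0 < d) (hk : 0 < k) (hA : ∀ i, (A i).PosDef) : 0 < lamMin A :=
  eigenvalueSet_pos hA (Set.Nonempty.csInf_mem
    ⟨_, eigenvalues_mem_eigenvalueSet hA ⟨0, hk⟩ ⟨0, hd⟩⟩ (finite_eigenvalueSet A))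

theorem lamMin_le_lamMax (hd : 0 < d) (hk : 0 < k) (hA : ∀ i, (A i).PosDef) :
    lamMin A ≤ lamMax A :=
  csInf_le_csSup ⟨_, eigenvalues_mem_eigenvalueSet hA ⟨0, hk⟩ ⟨0, hd⟩⟩
    (finite_eigenvalueSet A).bddBelow (finite_eigenvalueSet A).bddAbove

theorem lamMin_mul_norm_sq_le (hA : ∀ i, (A i).PosDef) (i : Fin k) (x : Pt d) :
    lamMin A * ‖x‖ ^ 2 ≤ ellSq (A i) x := by
  rw [ellSq_eq_sum_eigenvalues (hA i).isHermitian,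
    ← (hA i).isHermitian.eigenvectorBasis.sum_sq_inner_right, Finset.mul_sum]
  gcongr with l
  exact csInf_le (finite_eigenvalueSet A).bddBelow (eigenvalues_mem_eigenvalueSet hA i l)

theorem ellSq_le_lamMax_mul_norm_sq (hA : ∀ i, (A i).PosDef) (i : Fin k) (x : Pt d) :
    ellSq (A i) x ≤ lamMax A * ‖x‖ ^ 2 := by
  rw [ellSq_eq_sum_eigenvalues (hA i).isHermitian,
    ← (hA i).isHermitian.eigenvectorBasis.sum_sq_inner_right, Finset.mul_sum]
  gcongr with l
  exact le_csSup (finite_eigenvalueSet A).bddAbove (eigenvalues_mem_eigenvalueSet hA i l)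

end Extremes

/-! ### Batches: the parallel axis theorem -/

section Batch

variable {d n : ℕ}

theorem sum_smul_sub_batchCentroid (x : Fin n → Pt d) {w : Fin n → ℝ} (hw : batchWeight w ≠ 0) :
    ∑ j, w j • (x j - batchCentroid x w) = 0 := by
  simp only [smul_sub, Finset.sum_sub_distrib, ← Finset.sum_smul]
  rw [batchCentroid]
  change _ - batchWeight w • _ = _
  rw [smul_smul, mul_inv_cancel₀ hw, one_smul, sub_self]

/-- The parallel axis theorem. -/
theorem sum_mul_ellSq_sub {A : Matrix (Fin d) (Fin d) ℝ} (hA : A.IsHermitian) (x : Fin n → Pt d)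
    {w : Fin n → ℝ} (hw : batchWeight w ≠ 0) (s : Pt d) :
    ∑ j, w j * ellSq A (x j - s) =
      batchWeight w * ellSq A (batchCentroid x w - s) +
        ∑ j, w j * ellSq A (x j - batchCentroid x w) := by
  -- The middle term vanishes after summation, since the weighted deviations from the centroid add
  -- up to zero.
  have h : ∀ j, w j * ellSq A (x j - s) = w j * ellSq A (x j - batchCentroid x w) +
      2 * ellBilin A (w j • (x j - batchCentroid x w)) (batchCentroid x w - s) +
      w j * ellSq A (batchCentroid x w - s) := fun j => by
    rw [← sub_add_sub_cancel (x j) (batchCentroid x w) s, ellSq_add hA, ellBilin_smul_left]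
    ring
  simp only [h, Finset.sum_add_distrib, ← Finset.mul_sum, ← ellBilin_sum_left,
    sum_smul_sub_batchCentroid x hw, ← Finset.sum_mul]
  simp [ellBilin, batchWeight]
  ring

theorem batchVariation_nonneg (x : Fin n → Pt d) {w : Fin n → ℝ} (hw : ∀ j, 0 ≤ w j) :
    0 ≤ batchVariation x w :=
  Finset.sum_nonneg fun j _ => mul_nonneg (hw j) (sq_nonneg _)

theorem batchCentroid_eq_of_forall {x : Fin n → Pt d} {w : Fin n → ℝ} (hw : batchWeight w ≠ 0)
    {p : Pt d} (hx : ∀ j, w j ≠ 0 → x j = p) : batchCentroid x w = p := by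
  have : ∑ j, w j • x j = batchWeight w • p := by
    rw [batchWeight, Finset.sum_smul]
    refine Finset.sum_congr rfl fun j _ => ?_
    by_cases h : w j = 0
    · simp [h]
    · rw [hx j h]
  rw [batchCentroid, this, smul_smul, inv_mul_cancel₀ hw, one_smul]

variable {k : ℕ} {A : Fin k → Matrix (Fin d) (Fin d) ℝ}

/-- Replacing the points of a batch by the centroid, without changing the fractions of the
clusters, costs little more than before. -/
theorem sum_ellSq_batchCentroid_le (hA : ∀ i, (A i).PosDef) (x : Fin n → Pt d) {w : Fin n → ℝ}
    (hw : ∀ j, 0 ≤ w j) {ξ : Fin k → Fin n → ℝ} (hξ : ∀ i j, 0 ≤ ξ i j)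
    (hξ1 : ∀ j, ∑ i, ξ i j = 1) (S : Fin k → Pt d) {η : ℝ} (hη : 0 < η) :
    ∑ i, (∑ j, ξ i j * w j) * ellSq (A i) (batchCentroid x w - S i) ≤
      (1 + η) * ∑ i, ∑ j, ξ i j * w j * ellSq (A i) (x j - S i) +
        (1 + 1 / η) * (lamMax A * batchVariation x w) := by
  have h : ∀ i j, ξ i j * w j * ellSq (A i) (batchCentroid x w - S i) ≤
      (1 + η) * (ξ i j * w j * ellSq (A i) (x j - S i)) +
        (1 + 1 / η) * (lamMax A * (ξ i j * (w j * ‖x j - batchCentroid x w‖ ^ 2))) := by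
    intro i j
    have h1 := ellSq_add_le (hA i) (x j - S i) (batchCentroid x w - x j) hη
    have h2 := ellSq_le_lamMax_mul_norm_sq hA i (batchCentroid x w - x j)
    have e : x j - S i + (batchCentroid x w - x j) = batchCentroid x w - S i := by abel
    rw [e] at h1
    rw [norm_sub_rev] at h2
    have hp : 0 ≤ 1 + 1 / η := by positivity
    have h3 := mul_le_mul_of_nonneg_left (h1.trans (add_le_add_right
      (mul_le_mul_of_nonneg_left h2 hp) _)) (mul_nonneg (hξ i j) (hw j))
    refine h3.trans (le_of_eq (by ring))
  calc _ = ∑ i, ∑ j, ξ i j * w j * ellSq (A i) (batchCentroid x w - S i) := by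
        simp only [Finset.sum_mul]
    _ ≤ _ := Finset.sum_le_sum fun i _ => Finset.sum_le_sum fun j _ => h i j
    _ = _ := by
        simp only [Finset.sum_add_distrib, ← Finset.mul_sum]
        -- The fractions of each point add up to one, so the errors of all clusters together make up
        -- a single variation.
        rw [Finset.sum_comm (f := fun i j => ξ i j * (w j * ‖x j - batchCentroid x w‖ ^ 2))]
        simp only [← Finset.sum_mul, hξ1, one_mul]
        rfl

/-- For a batch that belongs to a single cluster, replacing the points by the centroid lowers the
cost at least by the scaled variation. -/
theorem sum_ellSq_batchCentroid_add_le_of_single (hA : ∀ i, (A i).PosDef) (x : Fin n → Pt d)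
    {w : Fin n → ℝ} (hw : ∀ j, 0 ≤ w j) (hw0 : batchWeight w ≠ 0) {ξ : Fin k → Fin n → ℝ}
    (hξ1 : ∀ j, ∑ i, ξ i j = 1) (S : Fin k → Pt d) {i₀ : Fin k}
    (h0 : ∀ i j, i ≠ i₀ → ξ i j * w j = 0) :
    ∑ i, (∑ j, ξ i j * w j) * ellSq (A i) (batchCentroid x w - S i) +
        lamMin A * batchVariation x w ≤
      ∑ i, ∑ j, ξ i j * w j * ellSq (A i) (x j - S i) := by
  have h1 : ∀ j, ξ i₀ j * w j = w j := fun j => by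
    have : ∑ i, ξ i j * w j = ξ i₀ j * w j :=
      Finset.sum_eq_single i₀ (fun i _ hi => h0 i j hi) (by simp)
    rw [← this, ← Finset.sum_mul, hξ1, one_mul]
  rw [Finset.sum_eq_single i₀ (fun i _ hi => by simp [h0 i _ hi]) (by simp),
    Finset.sum_eq_single i₀ (fun i _ hi => by simp [h0 i _ hi]) (by simp)]
  simp only [h1]
  rw [sum_mul_ellSq_sub (hA i₀).isHermitian x hw0]
  change batchWeight w * _ + _ ≤ _
  refine add_le_add_right ?_ _
  rw [batchVariation, Finset.mul_sum]
  refine Finset.sum_le_sum fun j _ => ?_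
  have := mul_le_mul_of_nonneg_left
    (lamMin_mul_norm_sq_le hA i₀ (x j - batchCentroid x w)) (hw j)
  linarith

/-- All mass sits at one position, so the centroid is that position and the variation is zero; hence
`c` is arbitrary, and so is the way in which clusters share the batch. -/
theorem sum_ellSq_batchCentroid_add_eq_of_const (x : Fin n → Pt d)
    {w : Fin n → ℝ} (hw0 : batchWeight w ≠ 0) (ξ : Fin k → Fin n → ℝ)
    (S : Fin k → Pt d) {p : Pt d} (hx : ∀ j, w j ≠ 0 → x j = p) (c : ℝ) :
    ∑ i, (∑ j, ξ i j * w j) * ellSq (A i) (batchCentroid x w - S i) +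
        c * batchVariation x w =
      ∑ i, ∑ j, ξ i j * w j * ellSq (A i) (x j - S i) := by
  have hV : batchVariation x w = 0 := by
    refine Finset.sum_eq_zero fun j _ => ?_
    by_cases h : w j = 0
    · simp [h]
    · rw [batchCentroid_eq_of_forall hw0 hx, hx j h]
      simp
  rw [hV, mul_zero, add_zero, batchCentroid_eq_of_forall hw0 hx]
  refine Finset.sum_congr rfl fun i _ => ?_
  rw [Finset.sum_mul]
  refine Finset.sum_congr rfl fun j _ => ?_
  by_cases h : w j = 0
  · simp [h]
  · rw [hx j h]

end Batch

/-! ### Exchange arguments -/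

section Exchange

variable {d n k : ℕ}

/-- The value of the linear functional with coefficients `c` at the clustering `ξ`. -/
def linCost (X : WeightedDataSet d n) (c ξ : Fin k → Fin n → ℝ) : ℝ :=
  ∑ i, ∑ j, ξ i j * X.wt j * c i j

/-- A closed subset of the unit cube; an infinite upper bound imposes no condition. Compactness is
what makes both stages of the lexicographic minimisation succeed. -/
theorem isCompact_clusterings (X : WeightedDataSet d n) (lo : Fin k → ℝ)
    (hi : Fin k → WithTop ℝ) : IsCompact (clusterings X lo hi) := by
  have hsub : clusterings X lo hi ⊆ Set.Icc 0 1 := by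
    rintro ξ ⟨h0, h1, -⟩
    refine ⟨fun i j => h0 i j, fun i j => ?_⟩
    change ξ i j ≤ 1
    rw [← h1 j]
    exact Finset.single_le_sum (f := fun i => ξ i j) (fun i _ => h0 i j) (Finset.mem_univ i)
  refine isCompact_Icc.of_isClosed_subset ?_ hsub
  have hc : ∀ i, Continuous fun ξ : Fin k → Fin n → ℝ => ∑ j, ξ i j * X.wt j := fun i => by
    fun_prop
  have hset : clusterings X lo hi = (⋂ i, ⋂ j, {ξ | 0 ≤ ξ i j}) ∩ ((⋂ j, {ξ | ∑ i, ξ i j = 1}) ∩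
      ⋂ i, ({ξ | lo i ≤ ∑ j, ξ i j * X.wt j} ∩
        {ξ | ((∑ j, ξ i j * X.wt j : ℝ) : WithTop ℝ) ≤ hi i})) := by
    ext ξ
    simp only [clusterings, Set.mem_inter_iff, Set.mem_iInter]
    rfl
  rw [hset]
  refine IsClosed.inter ?_ (IsClosed.inter ?_ ?_)
  · exact isClosed_iInter fun i => isClosed_iInter fun j =>
      isClosed_le continuous_const (by fun_prop)
  · exact isClosed_iInter fun j => isClosed_eq (by fun_prop) continuous_const
  · refine isClosed_iInter fun i => IsClosed.inter (isClosed_le continuous_const (hc i)) ?_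
    generalize hi i = h
    induction h with
    | top => simp
    | coe r =>
      have : {ξ : Fin k → Fin n → ℝ | ((∑ j, ξ i j * X.wt j : ℝ) : WithTop ℝ) ≤ (r : WithTop ℝ)} =
          {ξ | ∑ j, ξ i j * X.wt j ≤ r} := by
        ext ξ
        exact WithTop.coe_le_coe
      exact this ▸ isClosed_le (hc i) continuous_const

theorem continuous_linCost (X : WeightedDataSet d n) (c : Fin k → Fin n → ℝ) :
    Continuous (linCost X c) := by
  unfold linCost
  fun_prop

/-- A lexicographic minimum of two linear functionals exists. -/
theorem exists_lex_min (X : WeightedDataSet d n) {lo : Fin k → ℝ} {hi : Fin k → WithTop ℝ}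
    (hne : (clusterings X lo hi).Nonempty) (c c' : Fin k → Fin n → ℝ) :
    ∃ ξ ∈ clusterings X lo hi, (∀ ξ' ∈ clusterings X lo hi, linCost X c ξ ≤ linCost X c ξ') ∧
      ∀ ξ' ∈ clusterings X lo hi, linCost X c ξ' = linCost X c ξ →
        linCost X c' ξ ≤ linCost X c' ξ' := by
  obtain ⟨ξ₀, hξ₀, hmin₀⟩ := (isCompact_clusterings X lo hi).exists_isMinOn hne
    (continuous_linCost X c).continuousOn
  -- The minimisers of the first functional again form a compact set, on which the second one is
  -- minimised.
  have hcomp : IsCompact (clusterings X lo hi ∩ {ξ | linCost X c ξ = linCost X c ξ₀}) :=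
    (isCompact_clusterings X lo hi).inter_right
      (isClosed_eq (continuous_linCost X c) continuous_const)
  obtain ⟨ξ, ⟨hξ, hξe⟩, hmin⟩ := hcomp.exists_isMinOn ⟨ξ₀, hξ₀, rfl⟩
    (continuous_linCost X c').continuousOn
  refine ⟨ξ, hξ, fun ξ' h' => ?_, fun ξ' h' he => hmin ⟨h', he.trans hξe⟩⟩
  rw [hξe]
  exact hmin₀ h'

/-- Two points can exchange weight between two clusters. -/
theorem exists_exchange (X : WeightedDataSet d n) {lo : Fin k → ℝ} {hi : Fin k → WithTop ℝ}
    {ξ : Fin k → Fin n → ℝ} (hξ : ξ ∈ clusterings X lo hi) {i i' : Fin k} (hii : i ≠ i')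
    {j j' : Fin n} (hjj : j ≠ j') (hj : 0 < ξ i j) (hj' : 0 < ξ i' j') :
    ∃ ξ' ∈ clusterings X lo hi, ∃ δ : ℝ, 0 < δ ∧ ∀ c : Fin k → Fin n → ℝ,
      linCost X c ξ' = linCost X c ξ + δ * (c i' j - c i j + c i j' - c i' j') := by
  have hw := X.wt_pos
  set δ := min (ξ i j * X.wt j) (ξ i' j' * X.wt j') with hδ
  have hδ0 : 0 < δ := lt_min (mul_pos hj (hw j)) (mul_pos hj' (hw j'))
  -- A rank-one change: weight `δ` of `j` moves from `i` to `i'`, and weight `δ` of `j'` moves back.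
  -- Since `σ` and `ρ` have zero sums, point totals and cluster weights stay fixed, and `δ` is small
  -- enough to keep all fractions nonnegative.
  let σ : Fin k → ℝ := fun l => (if l = i' then 1 else 0) - (if l = i then 1 else 0)
  let ρ : Fin n → ℝ := fun r => (if r = j then 1 else 0) - (if r = j' then 1 else 0)
  let ξ' : Fin k → Fin n → ℝ := fun l r => ξ l r + δ * σ l * ρ r / X.wt r
  have hmul : ∀ l r, ξ' l r * X.wt r = ξ l r * X.wt r + δ * σ l * ρ r := fun l r => by
    have := (hw r).ne'
    simp only [ξ']
    field_simp
  have hσ : ∑ l, σ l = 0 := by simp [σ]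
  have hρ : ∑ r, ρ r = 0 := by simp [ρ]
  obtain ⟨h0, h1, h2⟩ := hξ
  refine ⟨ξ', ⟨fun l r => ?_, fun r => ?_, fun l => ?_⟩, δ, hδ0, fun c => ?_⟩
  · have : 0 ≤ ξ' l r * X.wt r := by
      rw [hmul]
      have hp := mul_nonneg (h0 l r) (hw r).le
      by_cases c1 : l = i ∧ r = j
      · obtain ⟨rfl, rfl⟩ := c1
        have : δ ≤ ξ l r * X.wt r := min_le_left _ _
        simp [σ, ρ, hii, hjj]
        exact this
      by_cases c2 : l = i' ∧ r = j'
      · obtain ⟨rfl, rfl⟩ := c2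
        have : δ ≤ ξ l r * X.wt r := min_le_right _ _
        simp [σ, ρ, hii.symm, hjj.symm]
        exact this
      have hs : 0 ≤ σ l * ρ r := by
        simp only [σ, ρ]
        split_ifs <;> simp_all
      rw [mul_assoc]
      exact add_nonneg hp (mul_nonneg hδ0.le hs)
    exact nonneg_of_mul_nonneg_left this (hw r)
  · have : ∑ l, ξ' l r = ∑ l, ξ l r + (∑ l, σ l) * (δ * ρ r / X.wt r) := by
      rw [Finset.sum_mul, ← Finset.sum_add_distrib]
      exact Finset.sum_congr rfl fun l _ => by simp only [ξ']; ring
    rw [this, hσ, h1]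
    simp
  · have : ∑ r, ξ' l r * X.wt r = ∑ r, ξ l r * X.wt r := by
      simp only [hmul, Finset.sum_add_distrib, ← Finset.mul_sum, hρ, mul_zero, add_zero]
    rw [this]
    exact h2 l
  · have : linCost X c ξ' = linCost X c ξ + δ * ∑ l, σ l * ∑ r, ρ r * c l r := by
      unfold linCost
      simp only [hmul, add_mul, Finset.sum_add_distrib, Finset.mul_sum]
      congr 1
      exact Finset.sum_congr rfl fun l _ => Finset.sum_congr rfl fun r _ => by ring
    rw [this]
    simp only [σ, ρ, sub_mul, ite_mul, one_mul, zero_mul, Finset.sum_sub_distrib,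
      Finset.sum_ite_eq', Finset.mem_univ, if_true]
    ring

/-- A quadratic polynomial that goes weakly up, down and up again is constant. -/
theorem quadratic_const_of_alternating {p q r t₁ t₂ t₃ t₄ : ℝ} (h12 : t₁ < t₂) (h23 : t₂ < t₃)
    (h34 : t₃ < t₄)
    (g12 : p * t₁ ^ 2 + q * t₁ + r ≤ p * t₂ ^ 2 + q * t₂ + r)
    (g32 : p * t₃ ^ 2 + q * t₃ + r ≤ p * t₂ ^ 2 + q * t₂ + r)
    (g34 : p * t₃ ^ 2 + q * t₃ + r ≤ p * t₄ ^ 2 + q * t₄ + r) : p = 0 ∧ q = 0 := by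
  -- These are the chord slopes of the polynomial. Consecutive ones differ by `p * (t₃ - t₁)` and `p
  -- * (t₄ - t₂)`, so their signs force `p = 0`.
  have s12 : 0 ≤ p * (t₁ + t₂) + q := by
    refine nonneg_of_mul_nonneg_left (b := t₂ - t₁) ?_ (by linarith)
    nlinarith
  have s23 : p * (t₂ + t₃) + q ≤ 0 := by
    refine nonpos_of_mul_nonpos_left (b := t₃ - t₂) ?_ (by linarith)
    nlinarith
  have s34 : 0 ≤ p * (t₃ + t₄) + q := by
    refine nonneg_of_mul_nonneg_left (b := t₄ - t₃) ?_ (by linarith)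
    nlinarith
  have hp1 : p ≤ 0 := nonpos_of_mul_nonpos_left (b := t₃ - t₁) (by nlinarith) (by linarith)
  have hp2 : 0 ≤ p := nonneg_of_mul_nonneg_left (b := t₄ - t₂) (by nlinarith) (by linarith)
  have hp : p = 0 := le_antisymm hp1 hp2
  subst hp
  exact ⟨rfl, by linarith⟩

/-- In a lexicographic optimum, two clusters do not alternate twice on a line. -/
theorem no_alternation (X : WeightedDataSet d n) {A : Fin k → Matrix (Fin d) (Fin d) ℝ}
    (hA : ∀ i, (A i).PosDef) {lo : Fin k → ℝ} {hi : Fin k → WithTop ℝ} (S : Fin k → Pt d)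
    (τ : Fin n → ℝ) {ξ : Fin k → Fin n → ℝ} (hξ : ξ ∈ clusterings X lo hi)
    (hmin : ∀ ξ' ∈ clusterings X lo hi, linCost X (fun i j => ellSq (A i) (X.pt j - S i)) ξ ≤
      linCost X (fun i j => ellSq (A i) (X.pt j - S i)) ξ')
    (hmin' : ∀ ξ' ∈ clusterings X lo hi,
      linCost X (fun i j => ellSq (A i) (X.pt j - S i)) ξ' =
        linCost X (fun i j => ellSq (A i) (X.pt j - S i)) ξ →
      linCost X (fun i j => (i : ℝ) * τ j) ξ ≤ linCost X (fun i j => (i : ℝ) * τ j) ξ')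
    {c u : Pt d} {j₁ j₂ j₃ j₄ : Fin n}
    (hx : ∀ j ∈ ({j₁, j₂, j₃, j₄} : Set (Fin n)), X.pt j = c + τ j • u)
    (τ12 : τ j₁ < τ j₂) (τ23 : τ j₂ < τ j₃) (τ34 : τ j₃ < τ j₄) {i i' : Fin k} (hii : i ≠ i')
    (h1 : 0 < ξ i j₁) (h2 : 0 < ξ i' j₂) (h3 : 0 < ξ i j₃) (h4 : 0 < ξ i' j₄) : False := by
  set f : Fin k → Fin n → ℝ := fun i j => ellSq (A i) (X.pt j - S i) with hf
  -- Optimality against the exchange of `j` and `j'` orders the cost differences; in a tie the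
  -- exchanged clustering is optimal too, and the secondary functional decides.
  have ex : ∀ j j', τ j ≠ τ j' → 0 < ξ i j → 0 < ξ i' j' →
      f i j - f i' j ≤ f i j' - f i' j' ∧
      (f i j - f i' j = f i j' - f i' j' → ((i : ℝ) - i') * τ j ≤ ((i : ℝ) - i') * τ j') := by
    intro j j' hne hj hj'
    obtain ⟨ξ', hξ', δ, hδ, hc⟩ := exists_exchange X hξ hii (fun h => hne (congrArg τ h)) hj hj'
    have a1 := hmin ξ' hξ'
    rw [hc] at a1
    have a2 : 0 ≤ f i' j - f i j + f i j' - f i' j' :=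
      nonneg_of_mul_nonneg_right (by linarith) hδ
    refine ⟨by linarith, fun he => ?_⟩
    have a3 := hmin' ξ' hξ' (by
      rw [hc, show f i' j - f i j + f i j' - f i' j' = 0 by linarith]
      ring)
    rw [hc] at a3
    have a4 : 0 ≤ (i' : ℝ) * τ j - i * τ j + i * τ j' - i' * τ j' :=
      nonneg_of_mul_nonneg_right (by linarith) hδ
    linarith
  have hq : ∀ j ∈ ({j₁, j₂, j₃, j₄} : Set (Fin n)), f i j - f i' j =
      (ellSq (A i) u - ellSq (A i') u) * τ j ^ 2 +
        (2 * ellBilin (A i) u (c - S i) - 2 * ellBilin (A i') u (c - S i')) * τ j +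
        (ellSq (A i) (c - S i) - ellSq (A i') (c - S i')) := fun j hj => by
    simp only [hf]
    rw [hx j hj, ellSq_line (hA i).isHermitian, ellSq_line (hA i').isHermitian]
    ring
  have q1 := hq j₁ (by simp)
  have q2 := hq j₂ (by simp)
  have q3 := hq j₃ (by simp)
  have q4 := hq j₄ (by simp)
  have e12 := ex j₁ j₂ τ12.ne h1 h2
  have e32 := ex j₃ j₂ τ23.ne' h3 h2
  have e34 := ex j₃ j₄ τ34.ne h3 h4
  -- The difference polynomial rises, falls and rises weakly along the four positions.
  obtain ⟨hp0, hq0⟩ := quadratic_const_of_alternating τ12 τ23 τ34 (q1 ▸ q2 ▸ e12.1)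
    (q3 ▸ q2 ▸ e32.1) (q3 ▸ q4 ▸ e34.1)
  rw [hp0, hq0] at q1 q2 q3
  -- The polynomial is constant, so every exchange is a tie. The position `τ j₂` lies strictly
  -- between the other two, so the secondary inequalities give the index difference both signs.
  have m12 := e12.2 (by rw [q1, q2]; ring)
  have m32 := e32.2 (by rw [q3, q2]; ring)
  have hi1 : 0 ≤ (i : ℝ) - i' := by
    by_contra h
    nlinarith
  have hi2 : (i : ℝ) - i' ≤ 0 := by
    by_contra h
    nlinarith
  have hcast : ((i : ℕ) : ℝ) = (i' : ℕ) := by linarith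
  exact hii (Fin.ext (by exact_mod_cast hcast))

end Exchange

/-! ### Batches that meet several clusters -/

namespace Batching

variable {d n k m : ℕ} {X : WeightedDataSet d n} {𝓛 : Set (Set (Pt d))} {V : ℝ}

/-- `τ` is an affine coordinate on each line, in which the batches are ordered. -/
structure IsPosition (B : Batching X 𝓛 V m) (τ : Fin n → ℝ) : Prop where
  exists_line : ∀ L ∈ 𝓛, ∃ c u : Pt d, ∀ j, B.pointLine j = L → X.pt j = c + τ j • u
  monotone : ∀ b b', b < b' → B.line b = B.line b' → ∀ j j', 0 < B.mass b j → 0 < B.mass b' j' →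
    τ j ≤ τ j'

/-- The scalar product with the direction of a line, divided by its squared norm, is the line
parameter. One function serves all lines because each point is handled on exactly one. -/
theorem exists_isPosition (B : Batching X 𝓛 V m) : ∃ τ, B.IsPosition τ := by
  choose c u hu hL hord using B.left_to_right
  let τ : Fin n → ℝ := fun j =>
    inner ℝ (u _ (B.pointLine_mem j)) (X.pt j - c _ (B.pointLine_mem j)) /
      ‖u _ (B.pointLine_mem j)‖ ^ 2
  refine ⟨τ, fun L h => ⟨c L h, u L h, ?_⟩, fun b b' hb hbb j j' hj hj' => ?_⟩
  · rintro j rfl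
    have hmem := B.pt_mem j
    rw [hL _ h] at hmem
    obtain ⟨t, ht⟩ := hmem
    have hn : ‖u _ h‖ ^ 2 ≠ 0 := pow_ne_zero 2 (norm_ne_zero_iff.2 (hu _ h))
    have : τ j = t := by
      simp only [τ]
      rw [ht, add_sub_cancel_left, inner_smul_right, real_inner_self_eq_norm_sq,
        mul_div_cancel_right₀ _ hn]
    rw [this]
    exact ht
  · have h1 := B.mass_line b j hj
    have h2 := (B.mass_line b' j' hj').trans hbb.symm
    have h3 := hord _ (B.line_mem b) b b' hb rfl hbb.symm j j' hj hj'
    have e : ∀ r, B.pointLine r = B.line b → τ r =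
        inner ℝ (u _ (B.line_mem b)) (X.pt r - c _ (B.line_mem b)) /
          ‖u _ (B.line_mem b)‖ ^ 2 := by
      intro r hr
      simp only [τ, hr]
    rw [e j h1, e j' h2, inner_sub_right, inner_sub_right]
    gcongr

/-- The batch `b` has two points at different positions that meet different clusters. -/
def IsSplit (B : Batching X 𝓛 V m) (τ : Fin n → ℝ) (ξ : Fin k → Fin n → ℝ) (b : Fin m) : Prop :=
  ∃ j j' i i', 0 < B.mass b j ∧ 0 < B.mass b j' ∧ τ j < τ j' ∧ i ≠ i' ∧ 0 < ξ i j ∧ 0 < ξ i' j'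

/-- With mass at two positions, the left and the right point meet one common cluster only; every
further point is compared with one of these two. -/
theorem const_or_single_of_not_isSplit (B : Batching X 𝓛 V m) {τ : Fin n → ℝ}
    (hτ : B.IsPosition τ) {ξ : Fin k → Fin n → ℝ} (hξ : ∀ i j, 0 ≤ ξ i j)
    (hξ1 : ∀ j, ∑ i, ξ i j = 1) {b : Fin m} (hb : ¬B.IsSplit τ ξ b) :
    (∃ p, ∀ j, B.mass b j ≠ 0 → X.pt j = p) ∨
      ∃ i₀, ∀ i j, i ≠ i₀ → ξ i j * B.mass b j = 0 := by
  have hpos : ∀ {j}, B.mass b j ≠ 0 → 0 < B.mass b j := fun h =>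
    lt_of_le_of_ne (B.mass_nonneg b _) h.symm
  by_cases hall : ∀ j j', 0 < B.mass b j → 0 < B.mass b j' → τ j ≤ τ j'
  · left
    obtain ⟨c, u, hcu⟩ := hτ.exists_line _ (B.line_mem b)
    obtain ⟨j₀, -, hj₀⟩ := Finset.exists_ne_zero_of_sum_ne_zero (B.batch_nonempty b).ne'
    refine ⟨X.pt j₀, fun j hj => ?_⟩
    rw [hcu j (B.mass_line b j (hpos hj)), hcu j₀ (B.mass_line b j₀ (hpos hj₀)),
      le_antisymm (hall j j₀ (hpos hj) (hpos hj₀)) (hall j₀ j (hpos hj₀) (hpos hj))]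
  · right
    push Not at hall
    obtain ⟨j₁, j₀, h1, h0, hlt⟩ := hall
    obtain ⟨i₀, -, hi₀⟩ := Finset.exists_ne_zero_of_sum_ne_zero
      (show ∑ i, ξ i j₀ ≠ 0 by rw [hξ1]; exact one_ne_zero)
    have hi₀ : 0 < ξ i₀ j₀ := lt_of_le_of_ne (hξ _ _) hi₀.symm
    have key : ∀ {j j' i i'}, 0 < B.mass b j → 0 < B.mass b j' → τ j < τ j' → 0 < ξ i j →
        0 < ξ i' j' → i = i' := fun ha hb' hc hd he => by
      by_contra hne
      exact hb ⟨_, _, _, _, ha, hb', hc, hne, hd, he⟩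
    obtain ⟨i₁, -, hi₁⟩ := Finset.exists_ne_zero_of_sum_ne_zero
      (show ∑ i, ξ i j₁ ≠ 0 by rw [hξ1]; exact one_ne_zero)
    have hi₁ : 0 < ξ i₁ j₁ := lt_of_le_of_ne (hξ _ _) hi₁.symm
    obtain rfl := key h0 h1 hlt hi₀ hi₁
    refine ⟨i₀, fun i j hi => ?_⟩
    by_contra hne
    have hm := hpos (right_ne_zero_of_mul hne)
    have hx : 0 < ξ i j := lt_of_le_of_ne (hξ _ _) (left_ne_zero_of_mul hne).symm
    -- Since `τ j₀ < τ j₁`, the point `j` is strictly right of `j₀` or strictly left of `j₁`.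
    rcases lt_or_ge (τ j₀) (τ j) with h | h
    · exact hi (key h0 hm h hi₀ hx).symm
    · exact hi (key hm h1 (h.trans_lt hlt) hx hi₁)

/-- If no two clusters alternate twice on a line, then only few batches are split: each of them
contains (nearly) the first or the last occurrence of a cluster on its line. -/
theorem card_isSplit_le (hk : 0 < k) (B : Batching X 𝓛 V m) (h𝓛 : 𝓛.Finite) {τ : Fin n → ℝ}
    (hτ : B.IsPosition τ) {ξ : Fin k → Fin n → ℝ}
    (hno : ∀ L ∈ 𝓛, ∀ j₁ j₂ j₃ j₄, B.pointLine j₁ = L → B.pointLine j₂ = L → B.pointLine j₃ = L →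
      B.pointLine j₄ = L → τ j₁ < τ j₂ → τ j₂ < τ j₃ → τ j₃ < τ j₄ → ∀ i i', i ≠ i' →
      0 < ξ i j₁ → 0 < ξ i' j₂ → 0 < ξ i j₃ → 0 < ξ i' j₄ → False)
    [DecidablePred (B.IsSplit τ ξ)] :
    (Finset.univ.filter (B.IsSplit τ ξ)).card ≤ 4 * k * 𝓛.ncard := by
  classical
  -- The label `(i, true)` says that `i` meets the left one of two positions of the batch and never
  -- occurs beyond the right one; `(i, false)` is the mirror image.
  let P : Fin m → Fin k × Bool → Prop := fun b c =>
    ∃ j j', 0 < B.mass b j ∧ 0 < B.mass b j' ∧ τ j < τ j' ∧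
      bif c.2 then 0 < ξ c.1 j ∧ ∀ r, B.pointLine r = B.line b → 0 < ξ c.1 r → τ r ≤ τ j'
      else 0 < ξ c.1 j' ∧ ∀ r, B.pointLine r = B.line b → 0 < ξ c.1 r → τ j ≤ τ r
  have hP : ∀ b, ∃ c, B.IsSplit τ ξ b → P b c := by
    intro b
    by_cases hb : B.IsSplit τ ξ b
    · obtain ⟨j, j', i, i', hj, hj', hlt, hii, hi, hi'⟩ := hb
      by_cases hfirst : ∀ r, B.pointLine r = B.line b → 0 < ξ i' r → τ j ≤ τ r
      · exact ⟨(i', false), fun _ => ⟨j, j', hj, hj', hlt, hi', hfirst⟩⟩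
      by_cases hlast : ∀ r, B.pointLine r = B.line b → 0 < ξ i r → τ r ≤ τ j'
      · exact ⟨(i, true), fun _ => ⟨j, j', hj, hj', hlt, hi, hlast⟩⟩
      -- If neither label fits, `i'` occurs before `j` and `i` after `j'`, which gives the forbidden
      -- pattern i', i, i', i.
      push Not at hfirst hlast
      obtain ⟨r, hr, hrx, hrlt⟩ := hfirst
      obtain ⟨s, hs, hsx, hslt⟩ := hlast
      exact (hno _ (B.line_mem b) r j j' s hr (B.mass_line b j hj) (B.mass_line b j' hj') hs
        hrlt hlt hslt i' i hii.symm hrx hi hi' hsx).elim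
    · exact ⟨(⟨0, hk⟩, true), fun h => (hb h).elim⟩
  choose φ hφ using hP
  let T : Finset (Set (Pt d) × (Fin k × Bool)) := h𝓛.toFinset ×ˢ Finset.univ
  have hmaps : ∀ b ∈ Finset.univ.filter (B.IsSplit τ ξ), (B.line b, φ b) ∈ T := fun b _ => by
    simp [T, B.line_mem b]
  -- Two batches may touch at a common position, hence the bound 2. Of three, the middle one has
  -- positive extent and separates the outer two strictly, whereas the common label makes them
  -- touch.
  have hfib : ∀ y ∈ T, ((Finset.univ.filter (B.IsSplit τ ξ)).filter
      (fun b => (B.line b, φ b) = y)).card ≤ 2 := by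
    rintro ⟨L, c⟩ -
    by_contra! hcard
    set s := (Finset.univ.filter (B.IsSplit τ ξ)).filter (fun b => (B.line b, φ b) = (L, c))
    have hs : ∀ b ∈ s, B.line b = L ∧ P b c := fun b hb => by
      simp only [s, Finset.mem_filter, Prod.mk.injEq] at hb
      exact ⟨hb.2.1, hb.2.2 ▸ hφ _ hb.1.2⟩
    let e := s.orderEmbOfFin rfl
    let b₀ := e ⟨0, by omega⟩
    let b₁ := e ⟨1, by omega⟩
    let b₂ := e ⟨2, by omega⟩
    have h01 : b₀ < b₁ := e.lt_iff_lt.2 (by simp)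
    have h12 : b₁ < b₂ := e.lt_iff_lt.2 (by simp)
    have hmem : ∀ l, B.line (e l) = L ∧ P (e l) c := fun l => hs _ (s.orderEmbOfFin_mem rfl l)
    obtain ⟨l0, j₀, j₀', a0, a0', t0, p0⟩ := hmem ⟨0, by omega⟩
    obtain ⟨l1, j₁, j₁', a1, a1', t1, -⟩ := hmem ⟨1, by omega⟩
    obtain ⟨l2, j₂, j₂', a2, a2', t2, p2⟩ := hmem ⟨2, by omega⟩
    have u1 := hτ.monotone _ _ h01 (l0.trans l1.symm) _ _ a0' a1
    have u2 := hτ.monotone _ _ h12 (l1.trans l2.symm) _ _ a1' a2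
    have hle : τ j₂ ≤ τ j₀' := by
      rcases c with ⟨i, _ | _⟩
      · exact p2.2 _ ((B.mass_line _ _ a0').trans (l0.trans l2.symm)) p0.1
      · exact p0.2 _ ((B.mass_line _ _ a2).trans (l2.trans l0.symm)) p2.1
    linarith
  have hcard := Finset.card_le_mul_card_image_of_maps_to hmaps 2 hfib
  have hT : T.card = 𝓛.ncard * (k * 2) := by
    simp only [T, Finset.card_product, Finset.card_univ, Fintype.card_prod, Fintype.card_fin,
      Fintype.card_bool]
    rw [Set.ncard_eq_toFinset_card _ h𝓛]
  rw [hT] at hcard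
  linarith

end Batching

/-! ### Costs -/

section Cost

variable {d n k : ℕ} {A : Fin k → Matrix (Fin d) (Fin d) ℝ}

theorem cost_nonneg (X : WeightedDataSet d n) (hA : ∀ i, (A i).PosDef) {ξ : Fin k → Fin n → ℝ}
    (hξ : ∀ i j, 0 ≤ ξ i j) (S : Fin k → Pt d) : 0 ≤ cost X A ξ S :=
  Finset.sum_nonneg fun i _ => Finset.sum_nonneg fun j _ =>
    mul_nonneg (mul_nonneg (hξ i j) (X.wt_pos j).le) (ellSq_nonneg (hA i) _)

theorem siteCost_le (X : WeightedDataSet d n) (hA : ∀ i, (A i).PosDef) {lo : Fin k → ℝ}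
    {hi : Fin k → WithTop ℝ} {ξ : Fin k → Fin n → ℝ} (hξ : ξ ∈ clusterings X lo hi)
    (S : Fin k → Pt d) : siteCost X A lo hi S ≤ cost X A ξ S :=
  csInf_le ⟨0, by
    rintro _ ⟨ξ', h', rfl⟩
    exact cost_nonneg X hA h'.1 S⟩ ⟨ξ, hξ, rfl⟩

theorem siteCost_eq_of_forall_le (X : WeightedDataSet d n) {lo : Fin k → ℝ}
    {hi : Fin k → WithTop ℝ} {ξ : Fin k → Fin n → ℝ} (hξ : ξ ∈ clusterings X lo hi)
    {S : Fin k → Pt d} (hmin : ∀ ξ' ∈ clusterings X lo hi, cost X A ξ S ≤ cost X A ξ' S) :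
    siteCost X A lo hi S = cost X A ξ S :=
  IsLeast.csInf_eq ⟨⟨ξ, hξ, rfl⟩, by
    rintro _ ⟨ξ', h', rfl⟩
    exact hmin ξ' h'⟩

theorem optLS_le_cost (X : WeightedDataSet d n) {ξ : Fin k → Fin n → ℝ} (hξ : ∀ i j, 0 ≤ ξ i j)
    (hξ1 : ∀ j, ∑ i, ξ i j = 1) (S : Fin k → Pt d) :
    optLS k X ≤ cost X (fun _ => 1) ξ S := by
  have h1 : ∀ i : Fin k, ((fun _ => 1 : Fin k → Matrix (Fin d) (Fin d) ℝ) i).PosDef :=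
    fun _ => Matrix.PosDef.one
  have hmem : ξ ∈ clusterings X (fun _ : Fin k => (0 : ℝ)) (fun _ => (⊤ : WithTop ℝ)) :=
    ⟨hξ, hξ1, fun i => ⟨Finset.sum_nonneg fun j _ => mul_nonneg (hξ i j) (X.wt_pos j).le, le_top⟩⟩
  refine (csInf_le (s := clusteringCost X _ '' clusterings X _ _) ⟨0, ?_⟩
    (Set.mem_image_of_mem _ hmem)).trans (ciInf_le ⟨0, ?_⟩ S)
  · rintro _ ⟨ξ', h', rfl⟩
    exact Real.iInf_nonneg fun S' => cost_nonneg X h1 h'.1 S'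
  · rintro _ ⟨S', rfl⟩
    exact cost_nonneg X h1 hξ S'

theorem lamMin_mul_cost_one_le (X : WeightedDataSet d n) (hA : ∀ i, (A i).PosDef)
    {ξ : Fin k → Fin n → ℝ} (hξ : ∀ i j, 0 ≤ ξ i j) (S : Fin k → Pt d) :
    lamMin A * cost X (fun _ : Fin k => 1) ξ S ≤ cost X A ξ S := by
  simp only [cost, Finset.mul_sum, ellSq_one]
  refine Finset.sum_le_sum fun i _ => Finset.sum_le_sum fun j _ => ?_
  have := mul_le_mul_of_nonneg_left (lamMin_mul_norm_sq_le hA i (X.pt j - S i))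
    (mul_nonneg (hξ i j) (X.wt_pos j).le)
  linarith

/-- The cost of a clustering changes little if the points are moved a little. -/
theorem cost_one_le_move (X : WeightedDataSet d n) (Y : Fin n → Pt d) {ξ : Fin k → Fin n → ℝ}
    (hξ : ∀ i j, 0 ≤ ξ i j) (hξ1 : ∀ j, ∑ i, ξ i j = 1) (S : Fin k → Pt d) {η : ℝ} (hη : 0 < η) :
    cost X (fun _ : Fin k => 1) ξ S ≤ (1 + η) * cost (X.move Y) (fun _ : Fin k => 1) ξ S +
      (1 + 1 / η) * ∑ j, X.wt j * ‖X.pt j - Y j‖ ^ 2 := by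
  have e : ∑ j, X.wt j * ‖X.pt j - Y j‖ ^ 2 =
      ∑ i, ∑ j, ξ i j * X.wt j * ‖X.pt j - Y j‖ ^ 2 := by
    rw [Finset.sum_comm]
    refine Finset.sum_congr rfl fun j _ => ?_
    simp only [mul_assoc]
    rw [← Finset.sum_mul, hξ1, one_mul]
  rw [e]
  simp only [cost, Finset.mul_sum, ← Finset.sum_add_distrib]
  refine Finset.sum_le_sum fun i _ => Finset.sum_le_sum fun j _ => ?_
  have h := ellSq_add_le (Matrix.PosDef.one (n := Fin d) (R := ℝ)) (Y j - S i) (X.pt j - Y j) hη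
  rw [sub_add_sub_cancel', ellSq_one (X.pt j - Y j)] at h
  have := mul_le_mul_of_nonneg_left h (mul_nonneg (hξ i j) (X.wt_pos j).le)
  refine this.trans (le_of_eq ?_)
  simp only [WeightedDataSet.move]
  ring

end Cost

/-! ### The projection to the pencils -/

section Projection

variable {d n K : ℕ}

theorem IsOrthProj.norm_sub_le {L : Set (Pt d)} {x y z : Pt d} (h : IsOrthProj L x y)
    (hz : z ∈ L) : ‖x - y‖ ≤ ‖x - z‖ := by
  have h1 : ‖x - z‖ ^ 2 = ‖x - y‖ ^ 2 + ‖z - y‖ ^ 2 := by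
    rw [← sub_sub_sub_cancel_right x z y, norm_sub_sq_real, h.2 z hz]
    ring
  refine le_of_sq_le_sq ?_ (norm_nonneg _)
  nlinarith [sq_nonneg ‖z - y‖]

theorem IsOrthProj.infDist_eq {L : Set (Pt d)} {x y : Pt d} (h : IsOrthProj L x y) :
    Metric.infDist x L = ‖x - y‖ := by
  refine le_antisymm ((Metric.infDist_le_dist_of_mem h.1).trans_eq (dist_eq_norm _ _)) ?_
  refine (Metric.le_infDist ⟨y, h.1⟩).2 fun z hz => ?_
  rw [dist_eq_norm]
  exact h.norm_sub_le hz

/-- A net direction `q'` close to the unit vector from the centroid `c` to the point `x` yields `c +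
‖x - c‖ • q'` on a line of the pencil, at distance at most `ε₀ * ‖x - c‖`; the closest line does no
worse. -/
theorem IsPencilProjection.norm_sub_le {X : WeightedDataSet d n} {a : Fin n → Fin K}
    {Q : Finset (Pt d)} {Y : Fin n → Pt d} (hY : IsPencilProjection X a Q Y) {ε₀ : ℝ}
    (hQ : IsDirectionNet ε₀ Q) (j : Fin n) :
    ‖X.pt j - Y j‖ ≤ ε₀ * ‖X.pt j - intCentroid X a (a j)‖ := by
  obtain ⟨q, -, hproj, hmin⟩ := hY j
  set c := intCentroid X a (a j)
  by_cases hx : X.pt j - c = 0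
  -- There is no direction to normalise, but the centroid lies on every line of its pencil.
  · have := hproj.norm_sub_le (z := c) ⟨0, by simp⟩
    rw [hx] at this ⊢
    simpa using this
  · have hn : 0 < ‖X.pt j - c‖ := norm_pos_iff.2 hx
    obtain ⟨q', hq', hle⟩ := hQ.2 (‖X.pt j - c‖⁻¹ • (X.pt j - c)) (by
      rw [norm_smul, norm_inv, norm_norm, inv_mul_cancel₀ hn.ne'])
    rw [← hproj.infDist_eq]
    have hmem : c + ‖X.pt j - c‖ • q' ∈ lineThrough c q' := ⟨_, rfl⟩
    refine (hmin q' hq').trans ((Metric.infDist_le_dist_of_mem hmem).trans ?_)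
    have e : X.pt j - (c + ‖X.pt j - c‖ • q') =
        ‖X.pt j - c‖ • (‖X.pt j - c‖⁻¹ • (X.pt j - c) - q') := by
      rw [smul_sub, smul_smul, mul_inv_cancel₀ hn.ne', one_smul]
      abel
    rw [dist_eq_norm, e, norm_smul, norm_norm, mul_comm]
    gcongr

theorem finite_pencilLines (X : WeightedDataSet d n) (a : Fin n → Fin K) (Q : Finset (Pt d)) :
    (pencilLines X a Q).Finite := by
  refine ((Set.finite_univ (α := Fin n)).prod Q.finite_toSet |>.image
    fun p => lineThrough (intCentroid X a (a p.1)) p.2).subset ?_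
  rintro _ ⟨j, q, hq, rfl⟩
  exact ⟨(j, q), ⟨trivial, hq⟩, rfl⟩

theorem intCost_nonneg (X : WeightedDataSet d n) (a : Fin n → Fin K) : 0 ≤ intCost X a :=
  Finset.sum_nonneg fun j _ => mul_nonneg (X.wt_pos j).le (sq_nonneg _)

theorem IsPencilProjection.sum_sq_le {X : WeightedDataSet d n} {a : Fin n → Fin K}
    {Q : Finset (Pt d)} {Y : Fin n → Pt d} (hY : IsPencilProjection X a Q Y) {ε₀ : ℝ}
    (hQ : IsDirectionNet ε₀ Q) :
    ∑ j, X.wt j * ‖X.pt j - Y j‖ ^ 2 ≤ ε₀ ^ 2 * intCost X a := by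
  rw [intCost, Finset.mul_sum]
  refine Finset.sum_le_sum fun j _ => ?_
  have h := mul_le_mul_of_nonneg_left
    (pow_le_pow_left₀ (norm_nonneg _) (hY.norm_sub_le hQ j) 2) (X.wt_pos j).le
  rw [mul_pow] at h
  linarith

/-- The cost of the approximation is at most a multiple of the cost of any clustering of the
projected points. -/
theorem lamMin_mul_intCost_le {k : ℕ} (hd : 0 < d) (hk : 0 < k)
    {A : Fin k → Matrix (Fin d) (Fin d) ℝ} (hA : ∀ i, (A i).PosDef) {ε α : ℝ} (hε : 0 < ε)
    (hε' : ε ≤ 1 / 2) (hα : 1 ≤ α) {X : WeightedDataSet d n} {a : Fin n → Fin K}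
    (ha : intCost X a ≤ α * optLS k X) {Q : Finset (Pt d)}
    (hQ : IsDirectionNet (ε / 4 * Real.sqrt (lamMin A / (α * lamMax A))) Q)
    {Y : Fin n → Pt d} (hY : IsPencilProjection X a Q Y) {ξ : Fin k → Fin n → ℝ}
    (hξ : ∀ i j, 0 ≤ ξ i j) (hξ1 : ∀ j, ∑ i, ξ i j = 1) (S : Fin k → Pt d) :
    lamMin A * intCost X a / α ≤ 64 / 49 * cost (X.move Y) A ξ S := by
  have hl := lamMin_pos hd hk hA
  have hlm := lamMin_le_lamMax hd hk hA
  have hL : 0 < lamMax A := hl.trans_le hlm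
  have hα0 : 0 < α := by linarith
  have hI := intCost_nonneg X a
  have h1 := optLS_le_cost X hξ hξ1 S
  -- With `η = 1/7` the factors are 8/7 and 8. The displacement is at most `I / α / 64` by `h6`
  -- below, so 7/8 of `I / α` is at most 8/7 of the Euclidean cost, which gives 64/49.
  have h2 := cost_one_le_move X Y hξ hξ1 S (η := 1 / 7) (by norm_num)
  have h3 := hY.sum_sq_le hQ
  have h4 := lamMin_mul_cost_one_le (X.move Y) hA hξ S
  have h5 : (ε / 4 * Real.sqrt (lamMin A / (α * lamMax A))) ^ 2 ≤ 1 / 64 / α := by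
    rw [mul_pow, Real.sq_sqrt (by positivity)]
    have e1 : (ε / 4) ^ 2 ≤ 1 / 64 := by nlinarith
    have e2 : lamMin A / (α * lamMax A) ≤ 1 / α := by
      rw [div_le_div_iff₀ (by positivity) hα0]
      nlinarith
    calc _ ≤ 1 / 64 * (1 / α) := by gcongr
      _ = _ := by ring
  have h6 := mul_le_mul_of_nonneg_right h5 hI
  set I := intCost X a
  set C := cost (X.move Y) (fun _ : Fin k => 1) ξ S
  have h7 : I / α ≤ optLS k X := by
    rw [div_le_iff₀ hα0]
    linarith
  have h8 : 1 / 64 / α * I = 1 / 64 * (I / α) := by ring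
  have h9 : I / α ≤ 64 / 49 * C := by
    norm_num at h2
    linarith
  calc lamMin A * I / α = lamMin A * (I / α) := by ring
    _ ≤ lamMin A * (64 / 49 * C) := by gcongr
    _ ≤ _ := by linarith

end Projection

/-! ### Transport of clusterings between the points and the batches -/

namespace Batching

variable {d n k m : ℕ} {X : WeightedDataSet d n} {𝓛 : Set (Set (Pt d))} {V : ℝ}

/-- The clustering of the points that is induced by a clustering of the batches. -/
def pull (B : Batching X 𝓛 V m) (ξ : Fin k → Fin m → ℝ) : Fin k → Fin n → ℝ :=
  fun i j => (∑ b, ξ i b * B.mass b j) / X.wt j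

/-- The clustering of the batches that is induced by a clustering of the points. -/
def push (B : Batching X 𝓛 V m) (ξ : Fin k → Fin n → ℝ) : Fin k → Fin m → ℝ :=
  fun i b => (∑ j, ξ i j * B.mass b j) / batchWeight (B.mass b)

theorem pull_mul_wt (B : Batching X 𝓛 V m) (ξ : Fin k → Fin m → ℝ) (i : Fin k) (j : Fin n) :
    B.pull ξ i j * X.wt j = ∑ b, ξ i b * B.mass b j :=
  div_mul_cancel₀ _ (X.wt_pos j).ne'

theorem push_mul_wt (B : Batching X 𝓛 V m) (ξ : Fin k → Fin n → ℝ) (i : Fin k) (b : Fin m) :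
    B.push ξ i b * B.batched.wt b = ∑ j, ξ i j * B.mass b j :=
  div_mul_cancel₀ _ (B.batch_nonempty b).ne'

/-- Counting the masses by points or by batches gives each cluster the same weight, so the bounds
carry over without slack. -/
theorem pull_mem (B : Batching X 𝓛 V m) {lo : Fin k → ℝ} {hi : Fin k → WithTop ℝ}
    {ξ : Fin k → Fin m → ℝ} (hξ : ξ ∈ clusterings B.batched lo hi) :
    B.pull ξ ∈ clusterings X lo hi := by
  obtain ⟨h0, h1, h2⟩ := hξ
  refine ⟨fun i j => div_nonneg (Finset.sum_nonneg fun b _ =>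
    mul_nonneg (h0 i b) (B.mass_nonneg b j)) (X.wt_pos j).le, fun j => ?_, fun i => ?_⟩
  · simp only [pull, ← Finset.sum_div]
    rw [Finset.sum_comm]
    simp only [← Finset.sum_mul, h1, one_mul, B.mass_sum]
    exact div_self (X.wt_pos j).ne'
  · have : ∑ j, B.pull ξ i j * X.wt j = ∑ b, ξ i b * B.batched.wt b := by
      simp only [pull_mul_wt]
      rw [Finset.sum_comm]
      simp only [← Finset.mul_sum]
      rfl
    rw [this]
    exact h2 i

theorem push_mem (B : Batching X 𝓛 V m) {lo : Fin k → ℝ} {hi : Fin k → WithTop ℝ}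
    {ξ : Fin k → Fin n → ℝ} (hξ : ξ ∈ clusterings X lo hi) :
    B.push ξ ∈ clusterings B.batched lo hi := by
  obtain ⟨h0, h1, h2⟩ := hξ
  refine ⟨fun i b => div_nonneg (Finset.sum_nonneg fun j _ =>
    mul_nonneg (h0 i j) (B.mass_nonneg b j)) (B.batch_nonempty b).le, fun b => ?_, fun i => ?_⟩
  · simp only [push, ← Finset.sum_div]
    rw [Finset.sum_comm]
    simp only [← Finset.sum_mul, h1, one_mul]
    exact div_self (B.batch_nonempty b).ne'
  · have : ∑ b, B.push ξ i b * B.batched.wt b = ∑ j, ξ i j * X.wt j := by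
      simp only [push_mul_wt]
      rw [Finset.sum_comm]
      simp only [← Finset.mul_sum, B.mass_sum]
    rw [this]
    exact h2 i

theorem totalVariation_nonneg (B : Batching X 𝓛 V m) : 0 ≤ B.totalVariation :=
  Finset.sum_nonneg fun b _ => batchVariation_nonneg _ (B.mass_nonneg b)

variable {A : Fin k → Matrix (Fin d) (Fin d) ℝ}

/-- All points of a batch share its fractions, so the parallel axis theorem applies for each batch
and cluster separately, without relative error. -/
theorem cost_pull_le (B : Batching X 𝓛 V m) (hA : ∀ i, (A i).PosDef) {ξ : Fin k → Fin m → ℝ}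
    (hξ : ∀ i b, 0 ≤ ξ i b) (hξ1 : ∀ b, ∑ i, ξ i b = 1) (S : Fin k → Pt d) :
    cost X A (B.pull ξ) S ≤ cost B.batched A ξ S + lamMax A * B.totalVariation := by
  have e1 : cost X A (B.pull ξ) S =
      ∑ i, ∑ b, ξ i b * ∑ j, B.mass b j * ellSq (A i) (X.pt j - S i) := by
    simp only [cost, pull_mul_wt]
    refine Finset.sum_congr rfl fun i _ => ?_
    simp only [Finset.sum_mul, Finset.mul_sum]
    rw [Finset.sum_comm]
    simp only [mul_assoc]
  have e2 : lamMax A * B.totalVariation =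
      ∑ i, ∑ b, ξ i b * (lamMax A * batchVariation X.pt (B.mass b)) := by
    rw [Finset.sum_comm]
    simp only [← Finset.sum_mul, hξ1, one_mul]
    rw [totalVariation, Finset.mul_sum]
  rw [e1, e2, cost]
  simp only [← Finset.sum_add_distrib]
  refine Finset.sum_le_sum fun i _ => Finset.sum_le_sum fun b _ => ?_
  rw [sum_mul_ellSq_sub (hA i).isHermitian _ (B.batch_nonempty b).ne', mul_assoc, ← mul_add]
  refine mul_le_mul_of_nonneg_left (add_le_add_right ?_ _) (hξ i b)
  rw [batchVariation, Finset.mul_sum]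
  refine Finset.sum_le_sum fun j _ => ?_
  have := mul_le_mul_of_nonneg_left (ellSq_le_lamMax_mul_norm_sq hA i
    (X.pt j - batchCentroid X.pt (B.mass b))) (B.mass_nonneg b j)
  linarith

theorem cost_eq_sum_batches (B : Batching X 𝓛 V m) (ξ : Fin k → Fin n → ℝ) (S : Fin k → Pt d) :
    cost X A ξ S = ∑ b, ∑ i, ∑ j, ξ i j * B.mass b j * ellSq (A i) (X.pt j - S i) := by
  rw [Finset.sum_comm, cost]
  refine Finset.sum_congr rfl fun i _ => ?_
  rw [Finset.sum_comm]
  refine Finset.sum_congr rfl fun j _ => ?_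
  rw [← Finset.sum_mul, ← Finset.mul_sum, B.mass_sum]

theorem cost_push (B : Batching X 𝓛 V m) (ξ : Fin k → Fin n → ℝ) (S : Fin k → Pt d) :
    cost B.batched A (B.push ξ) S = ∑ b, ∑ i, (∑ j, ξ i j * B.mass b j) *
      ellSq (A i) (batchCentroid X.pt (B.mass b) - S i) := by
  rw [Finset.sum_comm]
  simp only [cost, push_mul_wt]
  rfl

open Classical in
/-- Passing to the batches lowers the cost by the scaled total variation, up to a relative error
and an error for each split batch. -/
theorem cost_push_add_le (hd : 0 < d) (hk : 0 < k) (B : Batching X 𝓛 V m)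
    (hA : ∀ i, (A i).PosDef) {τ : Fin n → ℝ} (hτ : B.IsPosition τ) {ξ : Fin k → Fin n → ℝ}
    (hξ : ∀ i j, 0 ≤ ξ i j) (hξ1 : ∀ j, ∑ i, ξ i j = 1) (S : Fin k → Pt d) {η : ℝ} (hη : 0 < η) :
    cost B.batched A (B.push ξ) S + lamMin A * B.totalVariation ≤
      (1 + η) * cost X A ξ S + ((Finset.univ.filter (B.IsSplit τ ξ)).card : ℝ) *
        ((2 + 1 / η) * (lamMax A * V)) := by
  have hl := lamMin_pos hd hk hA
  have hlm := lamMin_le_lamMax hd hk hA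
  rw [B.cost_push, B.cost_eq_sum_batches, totalVariation, Finset.mul_sum, Finset.mul_sum,
    ← Finset.sum_add_distrib, ← nsmul_eq_mul, ← Finset.sum_const, Finset.sum_filter,
    ← Finset.sum_add_distrib]
  refine Finset.sum_le_sum fun b _ => ?_
  have hO : 0 ≤ ∑ i, ∑ j, ξ i j * B.mass b j * ellSq (A i) (X.pt j - S i) :=
    Finset.sum_nonneg fun i _ => Finset.sum_nonneg fun j _ =>
      mul_nonneg (mul_nonneg (hξ i j) (B.mass_nonneg b j)) (ellSq_nonneg (hA i) _)
  have hV0 := batchVariation_nonneg X.pt (B.mass_nonneg b)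
  have hV := B.variation_le b
  split_ifs with hb
  · have h := sum_ellSq_batchCentroid_le hA X.pt (B.mass_nonneg b) hξ hξ1 S hη
    -- For a split batch the variation on the left-hand side is pure loss; it raises the factor `1 +
    -- 1 / η` to `2 + 1 / η`.
    have h1 : lamMin A * batchVariation X.pt (B.mass b) ≤ lamMax A * V :=
      mul_le_mul hlm hV hV0 (hl.le.trans hlm)
    have h2 : (1 + 1 / η) * (lamMax A * batchVariation X.pt (B.mass b)) ≤
        (1 + 1 / η) * (lamMax A * V) := by
      have := hl.le.trans hlm
      gcongr
    linarith
  · have h : ∑ i, (∑ j, ξ i j * B.mass b j) *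
          ellSq (A i) (batchCentroid X.pt (B.mass b) - S i) +
        lamMin A * batchVariation X.pt (B.mass b) ≤
        ∑ i, ∑ j, ξ i j * B.mass b j * ellSq (A i) (X.pt j - S i) := by
      rcases B.const_or_single_of_not_isSplit hτ hξ hξ1 hb with ⟨p, hp⟩ | ⟨i₀, hi₀⟩
      · exact (sum_ellSq_batchCentroid_add_eq_of_const X.pt (B.batch_nonempty b).ne' ξ S hp _).le
      · exact sum_ellSq_batchCentroid_add_le_of_single hA X.pt (B.mass_nonneg b)
          (B.batch_nonempty b).ne' hξ1 S hi₀
    nlinarith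

open Classical in
/-- Some optimal clustering splits few batches. -/
theorem exists_optimal_card_isSplit_le (hk : 0 < k) (B : Batching X 𝓛 V m) (h𝓛 : 𝓛.Finite)
    (hA : ∀ i, (A i).PosDef) {lo : Fin k → ℝ} {hi : Fin k → WithTop ℝ}
    (hne : (clusterings X lo hi).Nonempty) {τ : Fin n → ℝ} (hτ : B.IsPosition τ)
    (S : Fin k → Pt d) :
    ∃ ξ ∈ clusterings X lo hi, (∀ ξ' ∈ clusterings X lo hi, cost X A ξ S ≤ cost X A ξ' S) ∧
      (Finset.univ.filter (B.IsSplit τ ξ)).card ≤ 4 * k * 𝓛.ncard := by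
  obtain ⟨ξ, hξ, hmin, hmin'⟩ := exists_lex_min X hne
    (fun i j => ellSq (A i) (X.pt j - S i)) (fun i j => (i : ℝ) * τ j)
  refine ⟨ξ, hξ, hmin, B.card_isSplit_le hk h𝓛 hτ ?_⟩
  intro L hL j₁ j₂ j₃ j₄ l1 l2 l3 l4 t12 t23 t34 i i' hii h1 h2 h3 h4
  obtain ⟨c, u, hcu⟩ := hτ.exists_line L hL
  refine no_alternation X hA S τ hξ hmin hmin' (c := c) (u := u) (fun j hj => hcu j ?_)
    t12 t23 t34 hii h1 h2 h3 h4
  rcases hj with rfl | rfl | rfl | rfl <;> assumption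

end Batching

end

end WCA

/-! ### The two coreset inequalities. -/

theorem theorem4p12 {d n k K m : ℕ} (hd : 0 < d) (hk : 0 < k)
    -- an instance of weight-constrained anisotropic clustering
    (X : WCA.WeightedDataSet d n)
    (A : Fin k → Matrix (Fin d) (Fin d) ℝ) (hA : ∀ i, (A i).PosDef)
    (lo : Fin k → ℝ) (hi : Fin k → WithTop ℝ)
    (hfeas : (WCA.clusterings X lo hi).Nonempty)
    (ε : ℝ) (hε : 0 < ε) (hε' : ε ≤ 1 / 2)
    -- an approximate least-squares clustering of `X`
    (α : ℝ) (hα : 1 ≤ α) (β : ℕ) (a : Fin n → Fin K)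
    (ha : WCA.IsApproximation α β k X a)
    -- the directions of the pencils, and the projected points
    (Q : Finset (WCA.Pt d))
    (hQ : WCA.IsDirectionNet (ε / 4 * Real.sqrt (WCA.lamMin A / (α * WCA.lamMax A))) Q)
    (Y : Fin n → WCA.Pt d) (hY : WCA.IsPencilProjection X a Q Y)
    -- the batches of the projected points
    (V : ℝ) (hV0 : 0 ≤ V)
    (hV : V ≤ ε ^ 2 * WCA.lamMin A /
      (32 * α * k * WCA.lamMax A * (WCA.pencilLines X a Q).ncard) * WCA.intCost X a)
    (B : WCA.Batching (X.move Y) (WCA.pencilLines X a Q) V m) :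
    WCA.IsCoreset ε (WCA.lamMax A / WCA.lamMin A) (X.move Y) B.batched A lo hi ∧
    WCA.IsCoresetWithOffsets ε (WCA.lamMax A / WCA.lamMin A)
      (WCA.lamMax A * B.totalVariation) (WCA.lamMin A * B.totalVariation)
      (X.move Y) B.batched A lo hi := by
  have hl := WCA.lamMin_pos hd hk hA
  have hlm := WCA.lamMin_le_lamMax hd hk hA
  have hL : 0 < WCA.lamMax A := hl.trans_le hlm
  have hT := B.totalVariation_nonneg
  suffices h : WCA.IsCoresetWithOffsets ε (WCA.lamMax A / WCA.lamMin A)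
      (WCA.lamMax A * B.totalVariation) (WCA.lamMin A * B.totalVariation)
      (X.move Y) B.batched A lo hi from ⟨⟨_, _, h⟩, h⟩
  refine ⟨⟨hε, hε'⟩, (one_le_div hl).2 hlm, ⟨by positivity, ?_⟩,
    -- The map does not depend on the sites.
    fun ξ => ⟨B.pull ξ.1, B.pull_mem ξ.2⟩, fun S => ⟨fun ξ => ?_, ?_⟩⟩
  · rw [← mul_assoc, div_mul_cancel₀ _ hl.ne']
  · have h1 := B.cost_pull_le hA ξ.2.1 ξ.2.2.1 S
    have h2 := WCA.cost_nonneg (X.move Y) hA (B.pull_mem ξ.2).1 S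
    nlinarith
  · classical
    obtain ⟨τ, hτ⟩ := B.exists_isPosition
    obtain ⟨ξ, hξ, hmin, hcard⟩ := B.exists_optimal_card_isSplit_le (lo := lo) (hi := hi) hk
      (WCA.finite_pencilLines X a Q) hA hfeas hτ S
    rw [WCA.siteCost_eq_of_forall_le (X.move Y) hξ hmin]
    have h1 := WCA.siteCost_le B.batched hA (B.push_mem hξ) S
    -- Half of `ε` is spent on the relative error of split batches, the other half on their additive
    -- errors.
    have h2 := B.cost_push_add_le hd hk hA hτ hξ.1 hξ.2.1 S (half_pos hε)
    have h3 := WCA.lamMin_mul_intCost_le hd hk hA hε hε' hα ha.2 hQ hY hξ.1 hξ.2.1 S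
    have hC := WCA.cost_nonneg (X.move Y) hA hξ.1 S
    have hI := WCA.intCost_nonneg X a
    set C := WCA.cost (X.move Y) A ξ S
    set I := WCA.intCost X a
    set M := (WCA.pencilLines X a Q).ncard
    set N := (Finset.univ.filter (B.IsSplit τ ξ)).card
    have hα0 : 0 < α := by linarith
    have hk0 : (0 : ℝ) < k := by exact_mod_cast hk
    have hcard' : (N : ℝ) ≤ 4 * k * M := by exact_mod_cast hcard
    have h4 : N * (WCA.lamMax A * V) ≤ ε ^ 2 / 8 * (WCA.lamMin A * I / α) := by
      have e0 : 0 ≤ ε ^ 2 / 8 * (WCA.lamMin A * I / α) := by positivity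
      have e1 : N * (WCA.lamMax A * V) ≤ 4 * k * M * (WCA.lamMax A * V) := by gcongr
      refine e1.trans ?_
      -- Without lines the bound on `V` divides by zero, but then the bound on the number of split
      -- batches vanishes.
      rcases Nat.eq_zero_or_pos M with hM | hM
      · rw [hM]
        simpa using e0
      · have hM0 : (0 : ℝ) < M := by exact_mod_cast hM
        calc _ ≤ 4 * k * M * (WCA.lamMax A * (ε ^ 2 * WCA.lamMin A /
              (32 * α * k * WCA.lamMax A * M) * I)) := by gcongr
          _ = _ := by
            field_simp
            ring
    have h5 : N * (WCA.lamMax A * V) ≤ 8 / 49 * ε ^ 2 * C := by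
      have := mul_le_mul_of_nonneg_left h3 (by positivity : 0 ≤ ε ^ 2 / 8)
      linarith
    -- The factor 8/49 is 64/49 times 1/8. Since `ε ≤ 1/2`, the resulting `16 / 49 * (ε + 1)` is at
    -- most 24/49, just below 1/2.
    have h6 : N * ((2 + 1 / (ε / 2)) * (WCA.lamMax A * V)) ≤ ε / 2 * C := by
      calc N * ((2 + 1 / (ε / 2)) * (WCA.lamMax A * V))
          = (2 + 1 / (ε / 2)) * (N * (WCA.lamMax A * V)) := by ring
        _ ≤ (2 + 1 / (ε / 2)) * (8 / 49 * ε ^ 2 * C) := by gcongr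
        _ = 16 / 49 * (ε + 1) * (ε * C) := by
            field_simp
            ring
        _ ≤ 1 / 2 * (ε * C) := by
            gcongr
            linarith
        _ = _ := by ring
    linarith
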